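/- Let $\mathcal H$ be a real Hilbert space, let $f:\mathcal H\to\mathbb R\cup\{+\infty\}$ be proper, convex and lower semicontinuous, and let $g:\mathcal H\to\mathbb R$ be convex and Fréchet differentiable with $\frac1\beta$-Lipschitz continuous gradient, where $\beta>0$. Assume that $\operatorname{argmin}_{x\in\mathcal H}\{f(x)+g(x)\}\neq\emptyset$, and let $\gamma\in(0,2\beta]$. For a function $h:\mathcal H\to\mathbb R\cup\{+\infty\}$ write $\operatorname{prox}_{h}(v)=\operatorname{argmin}_{y\in\mathcal H}\{h(y)+\frac12\|y-v\|^2\}$. Let $(\lambda_n)_{n\ge0}$ and $(\beta_n)_{n\ge0}$ be real sequences such that (i) $0<\beta_n\le1$ for all $n\ge0$, $\lim_{n\to\infty}\beta_n=1$, $\sum_{n\ge0}(1-\beta_n)=+\infty$ and $\sum_{n\ge1}|\beta_n-\beta_{n-1}|<+\infty$; (ii) $0<\lambda_n\le\frac{4\beta-\gamma}{2\beta}$ for all $n\ge0$, $\liminf_{n\to\infty}\lambda_n>0$ and $\sum_{n\ge1}|\lambda_n-\lambda_{n-1}|<+\infty$. Then $\operatorname{prox}_{\gamma f}$ is well defined,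 that is, $y\mapsto\gamma f(y)+\frac12\|y-v\|^2$ has exactly one minimizer for every $v\in\mathcal H$; and for every starting point $x_0\in\mathcal H$ the sequence defined by $$x_{n+1}=(1-\lambda_n)\beta_nx_n+\lambda_n\operatorname{prox}_{\gamma f}\big(\beta_nx_n-\gamma\nabla g(\beta_nx_n)\big)\qquad\text{for all } n\ge0$$ converges in norm to the unique minimizer of $f+g$ of smallest norm. -/

import Mathlib

open Filter Topology

namespace TikhonovFB

/-- `f : H → ℝ ∪ {+∞}` (modelled inside `EReal`) is proper: it never takes the value `-∞`
and is finite somewhere. -/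
def IsProper {H : Type*} (f : H → EReal) : Prop :=
  (∀ x, f x ≠ ⊥) ∧ ∃ x, f x ≠ ⊤

/-- Convexity of an extended-real-valued function. It is only used for functions that never take
the value `-∞`, so that the right-hand side is never of the form `∞ - ∞`. -/
def IsConvex {H : Type*} [AddCommGroup H] [Module ℝ H] (f : H → EReal) : Prop :=
  ∀ x y : H, ∀ s t : ℝ, 0 < s → 0 < t → s + t = 1 →
    f (s • x + t • y) ≤ (s : EReal) * f x + (t : EReal) * f y

/-- The set of global minimizers of an extended-real-valued function. -/
def argmin {H : Type*} (h : H → EReal) : Set H :=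
  {x | ∀ y, h x ≤ h y}

/-- The objective `y ↦ f y + ½ ‖y - x‖²` that defines the proximal point of `f` at `x`. -/
noncomputable def proxObjective {H : Type*} [NormedAddCommGroup H] (f : H → EReal) (x : H) :
    H → EReal :=
  fun y => f y + (((1 / 2 : ℝ) * ‖y - x‖ ^ 2 : ℝ) : EReal)

/-- The proximal operator: `prox f x` is the minimizer of `y ↦ f y + ½ ‖y - x‖²`. -/
noncomputable def prox {H : Type*} [NormedAddCommGroup H] (f : H → EReal) (x : H) : H :=
  Classical.epsilon fun p => p ∈ argmin (proxObjective f x)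

end TikhonovFB

/-! Put `T = prox_{γf} ∘ (I - γ∇g)`; its fixed points are the minimizers of `f + g`. Baillon–Haddad
cocoercivity of `∇g` and monotonicity of subgradients make `R = (2 - c)T - (1 - c)I`, `c = γ/(2β)`,
nonexpansive with the same fixed points. In terms of `R` the scheme is `x_{n+1} = y_n + μ_n (R y_n -
y_n)` with `y_n = b_n x_n` and `μ_n = λ_n/(2 - c) ∈ (0, 1]`.

Shrinking by `b_n` selects the fixed point `w` of least norm: `‖x_{n+1} - w‖² ≤ b_n ‖x_n - w‖² + 2(1
- b_n)⟪w, w - y_n⟫`, and Xu's lemma yields `x_n → w` once the limsup of the inner products is at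
most `0`. Xu's lemma also gives `x_{n+1} - x_n → 0` from the summable variations, hence `y_n - R y_n
→ 0`.

The limsup bound uses no weak compactness. The points `w_k` with `w_k - R w_k = -t_k w_k`, `t_k ↓
0`, converge in norm to `w`, and monotonicity of `I - R` compares each `w_k` with `y_n`. -/

open scoped RealInnerProductSpace

namespace TikhonovFB

/-! ### Real recursive inequalities -/

/-- Xu's lemma on real recursive inequalities. -/
theorem tendsto_zero_of_recursive_le {a θ δ ε : ℕ → ℝ} (ha : ∀ n, 0 ≤ a n)
    (hθ : ∀ n, 0 ≤ θ n ∧ θ n ≤ 1)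
    (hθdiv : Tendsto (fun N => ∑ n ∈ Finset.range N, θ n) atTop atTop)
    (hδ : ∀ e > 0, ∀ᶠ n in atTop, δ n ≤ e) (hε0 : ∀ n, 0 ≤ ε n) (hε : Summable ε)
    (hrec : ∀ n, a (n + 1) ≤ (1 - θ n) * a n + θ n * δ n + ε n) :
    Tendsto a atTop (𝓝 0) := by
  rw [Metric.tendsto_atTop]
  intro e he
  have htail := tendsto_sum_nat_add ε
  have h1 : ∀ᶠ N in atTop, ∑' k, ε (k + N) < e / 3 :=
    htail.eventually_lt_const (by positivity)
  obtain ⟨N₁, hN₁⟩ := eventually_atTop.1 (hδ (e / 3) (by positivity))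
  obtain ⟨N₂, hN₂⟩ := eventually_atTop.1 h1
  set N := max N₁ N₂ with hN
  -- Unrolling from `N`: the product of the factors `1 - θ` is at most `exp (-∑ θ)`, and each of the
  -- three summands ends up below or at `e / 3`.
  have key : ∀ n, a (n + N) ≤ e / 3 + ∑ k ∈ Finset.range n, ε (k + N)
      + a N * Real.exp (-∑ k ∈ Finset.range n, θ (k + N)) := by
    intro n
    induction n with
    | zero => simp; positivity
    | succ n ih =>
      have hd : δ (n + N) ≤ e / 3 := hN₁ _ (le_trans (le_max_left _ _) (Nat.le_add_left _ _))
      have hr := hrec (n + N)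
      obtain ⟨ht0, ht1⟩ := hθ (n + N)
      have hS : 0 ≤ ∑ k ∈ Finset.range n, ε (k + N) := Finset.sum_nonneg fun k _ => hε0 _
      rw [show n + 1 + N = n + N + 1 by ring, Finset.sum_range_succ, Finset.sum_range_succ,
        neg_add, Real.exp_add]
      have h2 : 1 - θ (n + N) ≤ Real.exp (-θ (n + N)) := by
        have := Real.add_one_le_exp (-θ (n + N)); linarith
      have h3 := mul_le_mul_of_nonneg_left ih (sub_nonneg.2 ht1)
      have h4 := mul_le_mul_of_nonneg_left hd ht0
      have h5 := mul_le_mul_of_nonneg_left h2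
        (mul_nonneg (ha N) (Real.exp_pos (-∑ k ∈ Finset.range n, θ (k + N))).le)
      have h6 := mul_nonneg ht0 hS
      nlinarith
  have hdiv : Tendsto (fun n => ∑ k ∈ Finset.range n, θ (k + N)) atTop atTop := by
    have h2 : Tendsto (fun n => ∑ k ∈ Finset.range (n + N), θ k) atTop atTop :=
      hθdiv.comp (tendsto_add_atTop_nat N)
    refine (tendsto_atTop_add_const_right _ (-∑ k ∈ Finset.range N, θ k) h2).congr fun n => ?_
    rw [add_comm n N, Finset.sum_range_add]
    simp [add_comm]
  have hexp : Tendsto (fun n => a N * Real.exp (-∑ k ∈ Finset.range n, θ (k + N)))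
      atTop (𝓝 (a N * 0)) :=
    (Real.tendsto_exp_neg_atTop_nhds_zero.comp hdiv).const_mul _
  rw [mul_zero] at hexp
  obtain ⟨M, hM⟩ := eventually_atTop.1 (hexp.eventually_lt_const (show (0 : ℝ) < e / 3 by positivity))
  refine ⟨M + N, fun n hn => ?_⟩
  obtain ⟨m, rfl⟩ : ∃ m, n = m + N := ⟨n - N, by omega⟩
  have hs : ∑ k ∈ Finset.range m, ε (k + N) ≤ ∑' k, ε (k + N) :=
    ((summable_nat_add_iff N).2 hε).sum_le_tsum _ fun k _ => hε0 _
  have h7 := hN₂ N (le_max_right _ _)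
  have h8 := hM m (by omega)
  rw [Real.dist_eq, sub_zero, abs_of_nonneg (ha _)]
  linarith [key m]

/-! ### Fixed points of nonexpansive maps -/

section Nonexpansive

variable {H : Type*} [NormedAddCommGroup H] [InnerProductSpace ℝ H]

theorem monotone_id_sub_of_nonexpansive {R : H → H} (hR : ∀ u v, ‖R u - R v‖ ≤ ‖u - v‖) (u v : H) :
    0 ≤ ⟪(u - R u) - (v - R v), u - v⟫ := by
  have h1 : (u - R u) - (v - R v) = (u - v) - (R u - R v) := by abel
  rw [h1, inner_sub_left, real_inner_self_eq_norm_sq]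
  have h2 := real_inner_le_norm (R u - R v) (u - v)
  nlinarith [hR u v, norm_nonneg (u - v)]

variable [CompleteSpace H]

/-- Banach's theorem applies to the contraction `(1 + ε)⁻¹ • R`. -/
theorem exists_regularized_zero {R : H → H} (hR : ∀ u v, ‖R u - R v‖ ≤ ‖u - v‖) {ε : ℝ}
    (hε : 0 < ε) : ∃ w, w - R w = -(ε • w) := by
  have hc : ContractingWith (Real.toNNReal (1 + ε)⁻¹) fun w => (1 + ε)⁻¹ • R w := by
    refine ⟨?_, LipschitzWith.of_dist_le_mul fun u v => ?_⟩
    · rw [Real.toNNReal_lt_one]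
      exact inv_lt_one_of_one_lt₀ (by linarith)
    · rw [dist_eq_norm, dist_eq_norm, ← smul_sub, norm_smul, Real.norm_of_nonneg (by positivity),
        Real.coe_toNNReal _ (by positivity)]
      exact mul_le_mul_of_nonneg_left (hR u v) (by positivity)
  refine ⟨hc.fixedPoint, ?_⟩
  have h := hc.fixedPoint_isFixedPt
  set w := hc.fixedPoint
  have h1 : (1 + ε)⁻¹ • R w = w := h
  have h2 : R w = (1 + ε) • w := by
    rw [← h1, smul_smul, mul_inv_cancel₀ (by positivity), one_smul, h1]
  rw [h2, add_smul, one_smul]; abel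

/-- The Tikhonov regularization path of a nonexpansive map converges to a fixed point `w`
such that `⟪w, w - y n⟫` is asymptotically nonpositive along bounded approximate fixed point
sequences. -/
theorem exists_fixedPoint_asymptotic_inner_nonpos {R : H → H}
    (hR : ∀ u v, ‖R u - R v‖ ≤ ‖u - v‖) {p : H} (hp : R p = p) :
    ∃ w, R w = w ∧ ∀ (y : ℕ → H) (C : ℝ), (∀ n, ‖y n‖ ≤ C) →
      Tendsto (fun n => ‖y n - R (y n)‖) atTop (𝓝 0) →
      ∀ e > 0, ∀ᶠ n in atTop, ⟪w, w - y n⟫ ≤ e := by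
  set t : ℕ → ℝ := fun k => 1 / ((k : ℝ) + 1) with ht
  have htpos : ∀ k, 0 < t k := fun k => by simp only [ht]; positivity
  have htanti : StrictAnti t := fun m n h => by
    simp only [ht]
    exact one_div_lt_one_div_of_lt (by positivity) (by simpa using h)
  choose w hw using fun k => exists_regularized_zero hR (htpos k)
  have hmono : ∀ k y, t k * ⟪w k, w k - y⟫ ≤ -⟪y - R y, w k - y⟫ := by
    intro k y
    have h := monotone_id_sub_of_nonexpansive hR (w k) y
    rw [hw, inner_sub_left, inner_neg_left, real_inner_smul_left] at h
    linarith
  have hgap : ∀ {u v : H}, ⟪u, u - v⟫ ≤ 0 → ‖v - u‖ ^ 2 ≤ ‖v‖ ^ 2 - ‖u‖ ^ 2 := by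
    intro u v h
    rw [inner_sub_right, real_inner_self_eq_norm_sq] at h
    rw [norm_sub_sq_real, real_inner_comm]
    linarith
  have hwp : ∀ k, ‖p - w k‖ ^ 2 ≤ ‖p‖ ^ 2 - ‖w k‖ ^ 2 := by
    intro k
    apply hgap
    have h := hmono k p
    rw [hp, sub_self, inner_zero_left, neg_zero] at h
    exact nonpos_of_mul_nonpos_right h (htpos k)
  -- Less regularization gives a larger norm, and the gain in `‖w k‖ ^ 2` dominates the squared
  -- distance; since these norms are bounded by `‖p‖`, the path is Cauchy.
  have hww : ∀ m n, m ≤ n → ‖w n - w m‖ ^ 2 ≤ ‖w n‖ ^ 2 - ‖w m‖ ^ 2 := by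
    intro m n hmn
    rcases hmn.eq_or_lt with rfl | hlt
    · simp
    apply hgap
    have h := hmono m (w n)
    rw [hw, inner_neg_left, real_inner_smul_left, neg_neg] at h
    have h1 : ⟪w n, w m - w n⟫ = ⟪w m, w m - w n⟫ - ‖w m - w n‖ ^ 2 := by
      rw [← real_inner_self_eq_norm_sq, ← inner_sub_left]
      congr 1; abel
    have h2 : (t m - t n) * ⟪w m, w m - w n⟫ ≤ 0 := by
      rw [h1] at h
      nlinarith [mul_nonneg (htpos n).le (sq_nonneg ‖w m - w n‖)]
    exact nonpos_of_mul_nonpos_right h2 (sub_pos.2 (htanti hlt))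
  have hwB : ∀ k, ‖w k‖ ≤ ‖p‖ := fun k =>
    abs_le_of_sq_le_sq' (by nlinarith [hwp k, sq_nonneg ‖p - w k‖]) (norm_nonneg _) |>.2
  have hcauchy : CauchySeq w := by
    have hm : Monotone fun k => ‖w k‖ ^ 2 := fun m n h => by
      have := hww m n h
      simp only
      nlinarith [sq_nonneg ‖w n - w m‖]
    have hb : BddAbove (Set.range fun k => ‖w k‖ ^ 2) :=
      ⟨‖p‖ ^ 2, by rintro _ ⟨k, rfl⟩; exact pow_le_pow_left₀ (norm_nonneg _) (hwB k) 2⟩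
    have hc := (tendsto_atTop_ciSup hm hb).cauchySeq
    rw [Metric.cauchySeq_iff'] at hc ⊢
    intro e he
    obtain ⟨N, hN⟩ := hc (e ^ 2) (by positivity)
    refine ⟨N, fun n hn => ?_⟩
    have h1 := hN n hn
    rw [Real.dist_eq] at h1
    rw [dist_eq_norm]
    exact lt_of_pow_lt_pow_left₀ 2 he.le ((hww N n hn).trans_lt ((le_abs_self _).trans_lt h1))
  obtain ⟨z, hz⟩ := cauchySeq_tendsto_of_complete hcauchy
  have ht0 : Tendsto t atTop (𝓝 0) := tendsto_one_div_add_atTop_nhds_zero_nat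
  have hRcont : Continuous R :=
    (LipschitzWith.of_dist_le_mul (K := 1) fun u v => by
      simpa [dist_eq_norm] using hR u v).continuous
  refine ⟨z, ?_, ?_⟩
  · have h1 : Tendsto (fun k => w k - R (w k)) atTop (𝓝 (z - R z)) :=
      hz.sub ((hRcont.tendsto z).comp hz)
    have h2 : Tendsto (fun k => w k - R (w k)) atTop (𝓝 (-((0 : ℝ) • z))) := by
      simp_rw [hw]
      exact (ht0.smul hz).neg
    have h3 := tendsto_nhds_unique h1 h2
    rw [zero_smul, neg_zero, sub_eq_zero] at h3
    exact h3.symm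
  · intro y C hC hy e he
    have hC0 : 0 ≤ C := (norm_nonneg _).trans (hC 0)
    have hz0 : Tendsto (fun k => ‖z - w k‖ * (‖z‖ + C + ‖p‖)) atTop (𝓝 0) := by
      have := ((tendsto_const_nhds (x := z)).sub hz).norm.mul_const (‖z‖ + C + ‖p‖)
      simpa using this
    obtain ⟨k, hk⟩ := (hz0.eventually_lt_const (half_pos he)).exists
    have hy0 : Tendsto (fun n => ‖y n - R (y n)‖ * (‖p‖ + C)) atTop (𝓝 0) := by
      simpa using hy.mul_const (‖p‖ + C)
    filter_upwards [hy0.eventually_lt_const (show 0 < t k * (e / 2) from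
      mul_pos (htpos k) (half_pos he))] with n hn
    have h1 : ⟪w k, w k - y n⟫ ≤ e / 2 := by
      have h2 := hmono k (y n)
      have h3 : -⟪y n - R (y n), w k - y n⟫ ≤ ‖y n - R (y n)‖ * (‖p‖ + C) := by
        refine (neg_le_abs _).trans ((abs_real_inner_le_norm _ _).trans ?_)
        refine mul_le_mul_of_nonneg_left ?_ (norm_nonneg _)
        exact (norm_sub_le _ _).trans (add_le_add (hwB k) (hC n))
      exact le_of_mul_le_mul_left (h2.trans (h3.trans hn.le)) (htpos k)
    -- The index `k` was fixed before `n`, so the last two terms are small uniformly in `n`.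
    have h4 : ⟪z, z - y n⟫ = ⟪w k, w k - y n⟫ + ⟪z - w k, z - y n⟫ + ⟪z - w k, w k⟫ := by
      rw [real_inner_comm (w k) (z - w k)]
      simp only [inner_sub_left, inner_sub_right]
      ring
    have h5 : ⟪z - w k, z - y n⟫ ≤ ‖z - w k‖ * (‖z‖ + C) :=
      (real_inner_le_norm _ _).trans (mul_le_mul_of_nonneg_left
        ((norm_sub_le _ _).trans (add_le_add le_rfl (hC n))) (norm_nonneg _))
    have h6 : ⟪z - w k, w k⟫ ≤ ‖z - w k‖ * ‖p‖ :=
      (real_inner_le_norm _ _).trans (mul_le_mul_of_nonneg_left (hwB k) (norm_nonneg _))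
    have h7 : ‖z - w k‖ * (‖z‖ + C + ‖p‖) = ‖z - w k‖ * (‖z‖ + C) + ‖z - w k‖ * ‖p‖ := by ring
    linarith

/-- Strong convergence of the Tikhonov-regularized Krasnosel'skii–Mann iteration. -/
theorem exists_minNorm_fixedPoint_tendsto {R : H → H}
    (hR : ∀ u v, ‖R u - R v‖ ≤ ‖u - v‖) {p : H} (hp : R p = p) {b μ : ℕ → ℝ}
    (hb : ∀ n, 0 < b n ∧ b n ≤ 1) (hblim : Tendsto b atTop (𝓝 1))
    (hbdiv : Tendsto (fun N => ∑ n ∈ Finset.range N, (1 - b n)) atTop atTop)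
    (hbvar : Summable fun n => |b (n + 1) - b n|)
    (hμ : ∀ n, 0 < μ n ∧ μ n ≤ 1) {c : ℝ} (hc : 0 < c) (hμc : ∀ᶠ n in atTop, c ≤ μ n)
    (hμvar : Summable fun n => |μ (n + 1) - μ n|) {x : ℕ → H}
    (hx : ∀ n, x (n + 1) = b n • x n + μ n • (R (b n • x n) - b n • x n)) :
    ∃ w, R w = w ∧ (∀ z, R z = z → z ≠ w → ‖w‖ < ‖z‖) ∧ Tendsto x atTop (𝓝 w) := by
  obtain ⟨w, hw, hlim⟩ := exists_fixedPoint_asymptotic_inner_nonpos hR hp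
  refine ⟨w, hw, ?_, ?_⟩
  · intro z hz hzw
    have h1 : ⟪w, w - z⟫ ≤ 0 := le_of_forall_pos_le_add fun e he => by
      have := hlim (fun _ => z) ‖z‖ (fun _ => le_rfl) (by simp [hz]) e he
      simpa using this.exists
    rw [inner_sub_right, real_inner_self_eq_norm_sq] at h1
    have h2 : 0 < ‖z - w‖ ^ 2 := by
      have := norm_pos_iff.2 (sub_ne_zero.2 hzw)
      positivity
    rw [norm_sub_sq_real, real_inner_comm] at h2
    exact lt_of_pow_lt_pow_left₀ 2 (norm_nonneg _) (by linarith)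
  have hrelax : ∀ n u v, ‖(u + μ n • (R u - u)) - (v + μ n • (R v - v))‖ ≤ ‖u - v‖ := by
    intro n u v
    have h1 : (u + μ n • (R u - u)) - (v + μ n • (R v - v))
        = (1 - μ n) • (u - v) + μ n • (R u - R v) := by module
    rw [h1]
    refine (norm_add_le _ _).trans ?_
    rw [norm_smul, norm_smul, Real.norm_of_nonneg (sub_nonneg.2 (hμ n).2),
      Real.norm_of_nonneg (hμ n).1.le]
    nlinarith [mul_le_mul_of_nonneg_left (hR u v) (hμ n).1.le]
  have hstep : ∀ n, ‖x (n + 1) - w‖ ≤ ‖b n • x n - w‖ := by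
    intro n
    have := hrelax n (b n • x n) w
    rwa [hw, sub_self, smul_zero, add_zero, ← hx] at this
  have hbd : ∀ n, ‖x n - w‖ ≤ max ‖x 0 - w‖ ‖w‖ := by
    intro n
    induction n with
    | zero => exact le_max_left _ _
    | succ n ih =>
      refine (hstep n).trans ?_
      have h1 : b n • x n - w = b n • (x n - w) - (1 - b n) • w := by module
      rw [h1]
      refine (norm_sub_le _ _).trans ?_
      rw [norm_smul, norm_smul, Real.norm_of_nonneg (hb n).1.le,
        Real.norm_of_nonneg (sub_nonneg.2 (hb n).2)]
      nlinarith [mul_le_mul_of_nonneg_left ih (hb n).1.le,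
        mul_le_mul_of_nonneg_left (le_max_right ‖x 0 - w‖ ‖w‖) (sub_nonneg.2 (hb n).2)]
  obtain ⟨C, hxC⟩ : ∃ C, ∀ n, ‖x n‖ ≤ C := ⟨max ‖x 0 - w‖ ‖w‖ + ‖w‖, fun n => by
    have := norm_le_norm_sub_add (x n) w
    linarith [hbd n]⟩
  have hC0 : 0 ≤ C := (norm_nonneg _).trans (hxC 0)
  have hyC : ∀ n, ‖b n • x n‖ ≤ C := fun n => by
    rw [norm_smul, Real.norm_of_nonneg (hb n).1.le]
    nlinarith [hxC n, norm_nonneg (x n), (hb n).1, (hb n).2]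
  obtain ⟨D, hRD⟩ : ∃ D, ∀ n, ‖R (b n • x n) - b n • x n‖ ≤ D := ⟨2 * (C + ‖w‖), fun n => by
    have h1 : R (b n • x n) - b n • x n = (R (b n • x n) - R w) - (b n • x n - w) := by
      rw [hw]; abel
    rw [h1]
    have h2 := norm_sub_le (R (b n • x n) - R w) (b n • x n - w)
    have h3 := norm_sub_le (b n • x n) w
    linarith [hR (b n • x n) w, hyC n]⟩
  have hD0 : 0 ≤ D := (norm_nonneg _).trans (hRD 0)
  have hdiff : Tendsto (fun n => ‖x (n + 1) - x n‖) atTop (𝓝 0) := by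
    -- The index is shifted because consecutive differences contract by `b (n + 1)`; the errors come
    -- from the variations of `b` and `μ`.
    refine tendsto_zero_of_recursive_le (θ := fun n => 1 - b (n + 1)) (δ := fun _ => 0)
      (ε := fun n => |b (n + 1) - b n| * C + |μ (n + 1) - μ n| * D) (fun _ => norm_nonneg _)
      (fun n => ⟨sub_nonneg.2 (hb _).2, by linarith [(hb (n + 1)).1]⟩) ?_
      (fun e he => Eventually.of_forall fun _ => he.le) (fun n => by positivity)
      ((hbvar.mul_right C).add (hμvar.mul_right D)) fun n => ?_
    · refine (tendsto_atTop_add_const_right _ (-(1 - b 0))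
        (hbdiv.comp (tendsto_add_atTop_nat 1))).congr fun n => ?_
      simp only [Function.comp]
      rw [Finset.sum_range_succ']
      ring
    · have h1 : x (n + 1 + 1) - x (n + 1) =
          ((b (n + 1) • x (n + 1) + μ (n + 1) • (R (b (n + 1) • x (n + 1)) - b (n + 1) • x (n + 1)))
            - (b n • x n + μ (n + 1) • (R (b n • x n) - b n • x n)))
          + (μ (n + 1) - μ n) • (R (b n • x n) - b n • x n) := by
        rw [hx (n + 1)]
        nth_rw 4 [hx n]
        module
      have h2 : b (n + 1) • x (n + 1) - b n • x n =
          b (n + 1) • (x (n + 1) - x n) + (b (n + 1) - b n) • x n := by module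
      have h3 := hrelax (n + 1) (b (n + 1) • x (n + 1)) (b n • x n)
      rw [h2] at h3
      have h4 := h3.trans (norm_add_le _ _)
      rw [norm_smul, norm_smul, Real.norm_of_nonneg (hb (n + 1)).1.le, Real.norm_eq_abs] at h4
      rw [h1]
      refine (norm_add_le _ _).trans ?_
      rw [norm_smul, Real.norm_eq_abs]
      have h5 := mul_le_mul_of_nonneg_left (hxC n) (abs_nonneg (b (n + 1) - b n))
      have h6 := mul_le_mul_of_nonneg_left (hRD n) (abs_nonneg (μ (n + 1) - μ n))
      linarith
  have hres : Tendsto (fun n => ‖b n • x n - R (b n • x n)‖) atTop (𝓝 0) := by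
    have hup : Tendsto (fun n => (‖x (n + 1) - x n‖ + (1 - b n) * C) / c) atTop (𝓝 0) := by
      simpa using (hdiff.add (((tendsto_const_nhds (x := (1 : ℝ))).sub hblim).mul_const C)).div_const c
    refine squeeze_zero' (Eventually.of_forall fun _ => norm_nonneg _) ?_ hup
    filter_upwards [hμc] with n hn
    rw [le_div_iff₀ hc, norm_sub_rev]
    have h1 : μ n • (R (b n • x n) - b n • x n) = (x (n + 1) - x n) + (1 - b n) • x n := by
      rw [hx n]; module
    have h2 := norm_add_le (x (n + 1) - x n) ((1 - b n) • x n)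
    rw [← h1, norm_smul, norm_smul, Real.norm_of_nonneg (hμ n).1.le,
      Real.norm_of_nonneg (sub_nonneg.2 (hb n).2)] at h2
    have h3 := mul_le_mul_of_nonneg_left (hxC n) (sub_nonneg.2 (hb n).2)
    have h4 := mul_le_mul_of_nonneg_right hn (norm_nonneg (R (b n • x n) - b n • x n))
    linarith
  have hsq : Tendsto (fun n => ‖x n - w‖ ^ 2) atTop (𝓝 0) := by
    refine tendsto_zero_of_recursive_le (θ := fun n => 1 - b n)
      (δ := fun n => 2 * ⟪w, w - b n • x n⟫) (ε := fun _ => 0) (fun _ => sq_nonneg _)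
      (fun n => ⟨sub_nonneg.2 (hb n).2, by linarith [(hb n).1]⟩) hbdiv ?_ (fun _ => le_rfl)
      summable_zero fun n => ?_
    · intro e he
      filter_upwards [hlim _ C hyC hres (e / 2) (half_pos he)] with n hn
      linarith
    · have h1 := pow_le_pow_left₀ (norm_nonneg _) (hstep n) 2
      have h2 : b n • (x n - w) = (b n • x n - w) + (1 - b n) • w := by module
      have h3 : b n ^ 2 * ‖x n - w‖ ^ 2 = ‖b n • x n - w‖ ^ 2
          + 2 * ((1 - b n) * ⟪w, b n • x n - w⟫) + (1 - b n) ^ 2 * ‖w‖ ^ 2 := by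
        have h4 := norm_add_sq_real (b n • x n - w) ((1 - b n) • w)
        rw [← h2, norm_smul, norm_smul, mul_pow, mul_pow, Real.norm_eq_abs, Real.norm_eq_abs,
          sq_abs, sq_abs, real_inner_smul_right, real_inner_comm] at h4
        exact h4
      have h5 : ⟪w, w - b n • x n⟫ = -⟪w, b n • x n - w⟫ := by rw [← inner_neg_right, neg_sub]
      rw [h5]
      have h6 : b n ^ 2 * ‖x n - w‖ ^ 2 ≤ b n * ‖x n - w‖ ^ 2 :=
        mul_le_mul_of_nonneg_right (by nlinarith [(hb n).1, (hb n).2]) (sq_nonneg _)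
      nlinarith [mul_nonneg (sq_nonneg (1 - b n)) (sq_nonneg ‖w‖)]
  rw [tendsto_iff_norm_sub_tendsto_zero]
  have := hsq.sqrt
  simpa [Real.sqrt_sq (norm_nonneg _)] using this

end Nonexpansive


/-! ### Extended-real arithmetic through real upper bounds -/

theorem ereal_add_coe_le_coe_iff {a : EReal} {q r : ℝ} :
    a + (q : EReal) ≤ (r : EReal) ↔ a ≤ ((r - q : ℝ) : EReal) := by
  induction a using EReal.rec with
  | bot => simp
  | top => simpa using (EReal.coe_ne_top (r - q))
  | coe a => norm_cast; exact le_sub_iff_add_le.symm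

theorem ereal_coe_mul_le_coe_iff {a : EReal} {c r : ℝ} (hc : 0 < c) :
    (c : EReal) * a ≤ (r : EReal) ↔ a ≤ ((r / c : ℝ) : EReal) := by
  induction a using EReal.rec with
  | bot => simp [EReal.coe_mul_bot_of_pos hc]
  | top => simp [EReal.coe_mul_top_of_pos hc]
  | coe a => norm_cast; rw [le_div_iff₀ hc, mul_comm]

section

variable {H : Type*}

theorem IsProper.eq_coe_of_le {F : H → EReal} (hF : IsProper F) {y : H} {r : ℝ}
    (h : F y ≤ r) : ∃ a : ℝ, F y = a := by
  refine ⟨(F y).toReal, (EReal.coe_toReal ?_ (hF.1 y)).symm⟩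
  exact (h.trans_lt (EReal.coe_lt_top r)).ne

theorem IsProper.exists_eq_coe {F : H → EReal} (hF : IsProper F) : ∃ y, ∃ a : ℝ, F y = a := by
  obtain ⟨y, hy⟩ := hF.2
  exact ⟨y, (F y).toReal, (EReal.coe_toReal hy (hF.1 y)).symm⟩

theorem IsProper.coe_mul {F : H → EReal} (hF : IsProper F) {c : ℝ} (hc : 0 < c) :
    IsProper fun y => (c : EReal) * F y := by
  obtain ⟨y, a, hy⟩ := hF.exists_eq_coe
  refine ⟨fun z => ?_, y, ?_⟩
  · have hz := hF.1 z
    simp only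
    generalize F z = a at hz ⊢
    induction a using EReal.rec with
    | bot => exact absurd rfl hz
    | top => simp [EReal.coe_mul_top_of_pos hc]
    | coe b => exact_mod_cast EReal.coe_ne_bot (c * b)
  · simp only [hy]
    exact_mod_cast EReal.coe_ne_top (c * a)

/-- Minimality of `p` for `F + q`, expressed through real upper bounds of `F`. -/
theorem mem_argmin_add_coe_iff {F : H → EReal} (hF : IsProper F) {q : H → ℝ} {p : H} :
    p ∈ argmin (fun y => F y + (q y : EReal)) ↔
      ∃ a : ℝ, F p = a ∧ ∀ y (r : ℝ), F y ≤ r → a + q p ≤ r + q y := by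
  constructor
  · intro h
    have h1 : ∀ y (r : ℝ), F y ≤ r → F p ≤ ((r + q y - q p : ℝ) : EReal) := by
      intro y r hr
      rw [← ereal_add_coe_le_coe_iff]
      refine (h y).trans ?_
      rw [ereal_add_coe_le_coe_iff, add_sub_cancel_right]
      exact hr
    obtain ⟨y₀, r₀, h₀⟩ := hF.exists_eq_coe
    obtain ⟨a, ha⟩ := hF.eq_coe_of_le (h1 y₀ r₀ h₀.le)
    refine ⟨a, ha, fun y r hr => ?_⟩
    have h2 := h1 y r hr
    rw [ha, EReal.coe_le_coe_iff] at h2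
    linarith
  · rintro ⟨a, ha, h⟩ y
    simp only [ha]
    by_cases hy : F y = ⊤
    · simp [hy]
    · have h1 := h y (F y).toReal (EReal.coe_toReal hy (hF.1 y)).ge
      rw [← EReal.coe_toReal hy (hF.1 y)]
      exact_mod_cast h1

end

section

variable {H : Type*} [AddCommGroup H] [Module ℝ H]

theorem IsConvex.le_coe {F : H → EReal} (hF : IsConvex F) {x y : H} {a b s t : ℝ}
    (hx : F x ≤ a) (hy : F y ≤ b) (hs : 0 < s) (ht : 0 < t) (hst : s + t = 1) :
    F (s • x + t • y) ≤ ((s * a + t * b : ℝ) : EReal) := by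
  refine (hF x y s t hs ht hst).trans ?_
  push_cast
  exact add_le_add (mul_le_mul_of_nonneg_left hx (by exact_mod_cast hs.le))
    (mul_le_mul_of_nonneg_left hy (by exact_mod_cast ht.le))

theorem IsConvex.coe_mul {F : H → EReal} (hF : IsConvex F) (hP : IsProper F) {c : ℝ} (hc : 0 < c) :
    IsConvex fun y => (c : EReal) * F y := by
  intro x y s t hs ht hst
  have hpos : ∀ {r : ℝ}, 0 < r → (r : EReal) * ((c : EReal) * ⊤) = ⊤ := fun h => by
    rw [EReal.coe_mul_top_of_pos hc, EReal.coe_mul_top_of_pos h]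
  have hnb : ∀ {r : ℝ} z, 0 < r → (r : EReal) * ((c : EReal) * F z) ≠ ⊥ := fun z h =>
    ((hP.coe_mul hc).coe_mul h).1 z
  by_cases hx : F x = ⊤
  · simp only [hx, hpos hs]
    rw [EReal.top_add_of_ne_bot (hnb y ht)]
    exact le_top
  by_cases hy : F y = ⊤
  · simp only [hy, hpos ht]
    rw [EReal.add_top_of_ne_bot (hnb x hs)]
    exact le_top
  have hx' := EReal.coe_toReal hx (hP.1 x)
  have hy' := EReal.coe_toReal hy (hP.1 y)
  have h := hF.le_coe hx'.ge hy'.ge hs ht hst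
  simp only
  rw [← hx', ← hy']
  have h2 : (s : EReal) * ((c : EReal) * ((F x).toReal : EReal)) +
      (t : EReal) * ((c : EReal) * ((F y).toReal : EReal)) =
      ((s * (c * (F x).toReal) + t * (c * (F y).toReal) : ℝ) : EReal) := by push_cast; rfl
  rw [h2, ereal_coe_mul_le_coe_iff hc]
  convert h using 2
  field_simp

end

theorem isClosed_coe_mul_le_of_lowerSemicontinuous {H : Type*} [TopologicalSpace H] {F : H → EReal}
    (hF : LowerSemicontinuous F) {c : ℝ} (hc : 0 < c) (r : ℝ) :
    IsClosed {y | (c : EReal) * F y ≤ r} := by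
  simp_rw [ereal_coe_mul_le_coe_iff hc]
  exact hF.isClosed_preimage _

/-! ### Subgradients and proximal points -/

section Subgradient

variable {H : Type*} [NormedAddCommGroup H] [InnerProductSpace ℝ H]

/-- `u` is a subgradient of `F` at `p`. -/
def IsSubgradientAt (F : H → EReal) (p u : H) : Prop :=
  ∃ a : ℝ, F p = a ∧ ∀ y (r : ℝ), F y ≤ r → a + ⟪u, y - p⟫ ≤ r

theorem isSubgradientAt_coe_mul_iff {F : H → EReal} (hF : IsProper F) {c : ℝ} (hc : 0 < c)
    {p u : H} : IsSubgradientAt (fun y => (c : EReal) * F y) p (c • u) ↔ IsSubgradientAt F p u := by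
  constructor
  · rintro ⟨a, ha, h⟩
    obtain ⟨b, hb⟩ := hF.eq_coe_of_le ((ereal_coe_mul_le_coe_iff hc).1 ha.le)
    refine ⟨b, hb, fun y r hr => ?_⟩
    have hab : a = c * b := by
      simp only [hb] at ha
      exact_mod_cast ha.symm
    have h1 := h y (c * r) ((ereal_coe_mul_le_coe_iff hc).2 (by
      rwa [mul_div_cancel_left₀ _ hc.ne']))
    rw [hab, real_inner_smul_left, ← mul_add] at h1
    exact le_of_mul_le_mul_left h1 hc
  · rintro ⟨a, ha, h⟩
    refine ⟨c * a, by simp only [ha]; norm_cast, fun y r hr => ?_⟩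
    have h1 := h y (r / c) ((ereal_coe_mul_le_coe_iff hc).1 hr)
    rw [le_div_iff₀ hc] at h1
    rw [real_inner_smul_left]
    linarith

theorem IsSubgradientAt.monotone {F : H → EReal} {p q u v : H} (hp : IsSubgradientAt F p u)
    (hq : IsSubgradientAt F q v) : 0 ≤ ⟪u - v, p - q⟫ := by
  obtain ⟨a, ha, h⟩ := hp
  obtain ⟨b, hb, k⟩ := hq
  have h1 := h q b hb.le
  have h2 := k p a ha.le
  rw [← neg_sub p q, inner_neg_right] at h1
  rw [inner_sub_left]
  linarith

theorem tendsto_slope_of_hasGradientAt [CompleteSpace H] {q : H → ℝ} {u p : H}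
    (hq : HasGradientAt q u p) (d : H) :
    Tendsto (fun t : ℝ => t⁻¹ * (q (p + t • d) - q p)) (𝓝[>] 0) (𝓝 ⟪u, d⟫) := by
  have h1 : HasDerivAt (fun t : ℝ => p + t • d) d 0 := by
    simpa using ((hasDerivAt_id (0 : ℝ)).smul_const d).const_add p
  have h0 : HasFDerivAt q ((InnerProductSpace.toDual ℝ H) u) (p + (0 : ℝ) • d) := by
    simpa using hq.hasFDerivAt
  have h2 : HasDerivAt (fun t : ℝ => q (p + t • d)) ⟪u, d⟫ 0 := by
    exact h0.comp_hasDerivAt (0 : ℝ) h1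
  simpa using h2.tendsto_slope_zero_right

/-- Compare `p` with `p + t • (y - p)`, bound `F` there by convexity, divide by `t` and let `t →
0⁺`. -/
theorem isSubgradientAt_of_mem_argmin_add [CompleteSpace H] {F : H → EReal} (hF : IsProper F)
    (hconv : IsConvex F) {q : H → ℝ} {p u : H} (hq : HasGradientAt q u p)
    (hp : p ∈ argmin (fun y => F y + (q y : EReal))) : IsSubgradientAt F p (-u) := by
  obtain ⟨a, ha, h⟩ := (mem_argmin_add_coe_iff hF).1 hp
  refine ⟨a, ha, fun y r hr => ?_⟩
  have h1 : a - r ≤ ⟪u, y - p⟫ := by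
    refine ge_of_tendsto (tendsto_slope_of_hasGradientAt hq (y - p)) ?_
    filter_upwards [Ioo_mem_nhdsGT (show (0 : ℝ) < 1 by norm_num)] with t ht
    have h2 := hconv.le_coe ha.le hr (sub_pos.2 ht.2) ht.1 (sub_add_cancel 1 t)
    rw [show (1 - t) • p + t • y = p + t • (y - p) by module] at h2
    have h3 := h _ _ h2
    rw [inv_mul_eq_div, le_div_iff₀ ht.1]
    linarith
  rw [inner_neg_left]
  linarith

theorem mem_argmin_add_of_isSubgradientAt {F : H → EReal} (hF : IsProper F) {q : H → ℝ} {p u : H}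
    (hq : ∀ y, q p + ⟪u, y - p⟫ ≤ q y) (hp : IsSubgradientAt F p (-u)) :
    p ∈ argmin (fun y => F y + (q y : EReal)) := by
  obtain ⟨a, ha, h⟩ := hp
  refine (mem_argmin_add_coe_iff hF).2 ⟨a, ha, fun y r hr => ?_⟩
  have h1 := h y r hr
  rw [inner_neg_left] at h1
  linarith [hq y]

theorem hasGradientAt_half_norm_sub_sq [CompleteSpace H] (v p : H) :
    HasGradientAt (fun y => (1 / 2 : ℝ) * ‖y - v‖ ^ 2) (p - v) p := by
  rw [hasGradientAt_iff_hasFDerivAt]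
  have h := (((hasFDerivAt_id p).sub_const v).norm_sq).const_mul (1 / 2 : ℝ)
  refine h.congr_fderiv ?_
  ext d
  simp

theorem half_norm_sub_sq_ge (v p y : H) :
    (1 / 2 : ℝ) * ‖p - v‖ ^ 2 + ⟪p - v, y - p⟫ ≤ (1 / 2 : ℝ) * ‖y - v‖ ^ 2 := by
  have h := norm_add_sq_real (p - v) (y - p)
  rw [show (p - v) + (y - p) = y - v by abel] at h
  nlinarith [sq_nonneg ‖y - p‖]

/-- `p` is the proximal point of `v` iff `v - p` is a subgradient at `p`. -/
theorem mem_argmin_proxObjective_iff [CompleteSpace H] {F : H → EReal} (hF : IsProper F)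
    (hconv : IsConvex F) {v p : H} :
    p ∈ argmin (proxObjective F v) ↔ IsSubgradientAt F p (v - p) := by
  rw [← neg_sub p v]
  exact ⟨isSubgradientAt_of_mem_argmin_add hF hconv (hasGradientAt_half_norm_sub_sq v p),
    mem_argmin_add_of_isSubgradientAt hF (half_norm_sub_sq_ge v p)⟩

/-- The known subgradient supplies an affine minorant, so no separation theorem is needed; strong
convexity makes a minimizing sequence Cauchy. -/
theorem exists_mem_argmin_proxObjective [CompleteSpace H] {F : H → EReal} (hF : IsProper F)
    (hconv : IsConvex F) (hlsc : ∀ r : ℝ, IsClosed {y | F y ≤ r}) {p₀ u : H}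
    (hu : IsSubgradientAt F p₀ u) (v : H) : ∃ p, p ∈ argmin (proxObjective F v) := by
  obtain ⟨a, ha, hmin⟩ := hu
  set S : Set ℝ := {r | ∃ y, ∃ s : ℝ, F y ≤ s ∧ r = s + 1 / 2 * ‖y - v‖ ^ 2} with hS
  have hSne : S.Nonempty := ⟨_, p₀, a, ha.le, rfl⟩
  have hSbdd : BddBelow S := by
    -- Completing the square in `⟪u, y - v⟫ + ½‖y - v‖²`.
    refine ⟨a + ⟪u, v - p₀⟫ - 1 / 2 * ‖u‖ ^ 2, ?_⟩
    rintro _ ⟨y, s, hs, rfl⟩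
    have h1 := hmin y s hs
    have h2 := norm_add_sq_real u (y - v)
    rw [show y - p₀ = (y - v) + (v - p₀) by abel, inner_add_right] at h1
    nlinarith [sq_nonneg ‖u + (y - v)‖]
  set m := sInf S
  have hm : ∀ y (s : ℝ), F y ≤ s → m ≤ s + 1 / 2 * ‖y - v‖ ^ 2 := fun y s hs =>
    csInf_le hSbdd ⟨y, s, hs, rfl⟩
  set t : ℕ → ℝ := fun k => 1 / ((k : ℝ) + 1) with ht
  have htpos : ∀ k, 0 < t k := fun k => by simp only [ht]; positivity
  have htanti : ∀ k n, k ≤ n → t n ≤ t k := fun k n h => by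
    simp only [ht]
    exact one_div_le_one_div_of_le (by positivity) (by simpa using h)
  have ht0 : Tendsto t atTop (𝓝 0) := tendsto_one_div_add_atTop_nhds_zero_nat
  have hex : ∀ k, ∃ y, ∃ s : ℝ, F y ≤ s ∧ s + 1 / 2 * ‖y - v‖ ^ 2 < m + t k := by
    intro k
    obtain ⟨_, ⟨y, s, hs, rfl⟩, h⟩ := exists_lt_of_csInf_lt hSne (lt_add_of_pos_right m (htpos k))
    exact ⟨y, s, hs, h⟩
  choose y s hys hlt using hex
  -- Test `m` at the midpoint and apply the parallelogram law.
  have hdist : ∀ n k, ‖y n - y k‖ ^ 2 ≤ 4 * (t n + t k) := by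
    intro n k
    have h1 := hm _ _ (hconv.le_coe (hys n) (hys k) (s := 1 / 2) (t := 1 / 2) (by norm_num)
      (by norm_num) (by norm_num))
    rw [show (1 / 2 : ℝ) • y n + (1 / 2 : ℝ) • y k - v = (1 / 2 : ℝ) • ((y n - v) + (y k - v)) by
      module, norm_smul, mul_pow, Real.norm_of_nonneg (by norm_num)] at h1
    have h2 := parallelogram_law_with_norm ℝ (y n - v) (y k - v)
    rw [sub_sub_sub_cancel_right] at h2
    nlinarith [hlt n, hlt k]
  have hcauchy : CauchySeq y := by
    rw [Metric.cauchySeq_iff']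
    intro e he
    obtain ⟨N, hN⟩ := (ht0.eventually_lt_const (show 0 < e ^ 2 / 8 by positivity)).exists
    refine ⟨N, fun n hn => ?_⟩
    rw [dist_eq_norm]
    refine lt_of_pow_lt_pow_left₀ 2 he.le ((hdist n N).trans_lt ?_)
    linarith [htanti N n hn]
  obtain ⟨p, hp⟩ := cauchySeq_tendsto_of_complete hcauchy
  have hFp : ∀ c : ℝ, m - 1 / 2 * ‖p - v‖ ^ 2 < c → F p ≤ c := by
    intro c hc
    have hlim : Tendsto (fun k => m + t k - 1 / 2 * ‖y k - v‖ ^ 2) atTop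
        (𝓝 (m + 0 - 1 / 2 * ‖p - v‖ ^ 2)) :=
      (tendsto_const_nhds.add ht0).sub (((hp.sub_const v).norm.pow 2).const_mul _)
    rw [add_zero] at hlim
    refine (hlsc c).mem_of_tendsto hp ?_
    filter_upwards [hlim.eventually_lt_const hc] with k hk
    exact (hys k).trans (by exact_mod_cast (by linarith [hlt k] : s k ≤ c))
  obtain ⟨b, hb⟩ := hF.eq_coe_of_le (hFp _ (lt_add_one _))
  refine ⟨p, (mem_argmin_add_coe_iff hF).2 ⟨b, hb, fun z r hr => ?_⟩⟩
  have h1 : b ≤ m - 1 / 2 * ‖p - v‖ ^ 2 := le_of_forall_gt_imp_ge_of_dense fun c hc => by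
    have := hFp c hc
    rw [hb] at this
    exact_mod_cast this
  linarith [hm z r hr]

theorem existsUnique_mem_argmin_proxObjective [CompleteSpace H] {F : H → EReal} (hF : IsProper F)
    (hconv : IsConvex F) (hlsc : ∀ r : ℝ, IsClosed {y | F y ≤ r}) {p₀ u : H}
    (hu : IsSubgradientAt F p₀ u) (v : H) : ∃! p, p ∈ argmin (proxObjective F v) := by
  refine existsUnique_of_exists_of_unique (exists_mem_argmin_proxObjective hF hconv hlsc hu v) ?_
  intro p q hp hq
  have h := ((mem_argmin_proxObjective_iff hF hconv).1 hp).monotone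
    ((mem_argmin_proxObjective_iff hF hconv).1 hq)
  rw [sub_sub_sub_cancel_left, ← neg_sub p q, inner_neg_left, real_inner_self_eq_norm_sq] at h
  have h1 : ‖p - q‖ ^ 2 = 0 := le_antisymm (by linarith) (sq_nonneg _)
  exact sub_eq_zero.1 (norm_eq_zero.1 (pow_eq_zero_iff two_ne_zero |>.1 h1))

end Subgradient

/-! ### Cocoercivity of a Lipschitz gradient -/

section Cocoercive

variable {H : Type*} [NormedAddCommGroup H] [InnerProductSpace ℝ H] [CompleteSpace H]

theorem convexOn_gradient_inequality {g : H → ℝ} (hg : ConvexOn ℝ Set.univ g) {x u : H}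
    (hx : HasGradientAt g u x) (y : H) : g x + ⟪u, y - x⟫ ≤ g y := by
  have h1 : ⟪u, y - x⟫ ≤ g y - g x := by
    refine le_of_tendsto (tendsto_slope_of_hasGradientAt hx (y - x)) ?_
    filter_upwards [Ioo_mem_nhdsGT (show (0 : ℝ) < 1 by norm_num)] with t ht
    have h2 := hg.2 (Set.mem_univ x) (Set.mem_univ y) (sub_pos.2 ht.2).le ht.1.le
      (sub_add_cancel 1 t)
    rw [show (1 - t) • x + t • y = x + t • (y - x) by module, smul_eq_mul, smul_eq_mul] at h2
    rw [inv_mul_eq_div, div_le_iff₀ ht.1]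
    linarith
  linarith

/-- The descent lemma for functions with Lipschitz gradient. -/
theorem descent_lemma {g : H → ℝ} (hg : Differentiable ℝ g) {L : ℝ}
    (hL : ∀ u v, ‖gradient g u - gradient g v‖ ≤ L * ‖u - v‖) (x d : H) :
    g (x + d) ≤ g x + ⟪gradient g x, d⟫ + L / 2 * ‖d‖ ^ 2 := by
  set φ : ℝ → ℝ := fun t => g (x + t • d) - t * ⟪gradient g x, d⟫ - L / 2 * ‖d‖ ^ 2 * t ^ 2
  have hφ : ∀ t, HasDerivAt φ
      (⟪gradient g (x + t • d), d⟫ - ⟪gradient g x, d⟫ - L / 2 * ‖d‖ ^ 2 * (2 * t)) t := by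
    intro t
    have h1 : HasDerivAt (fun t : ℝ => x + t • d) d t := by
      simpa using ((hasDerivAt_id t).smul_const d).const_add x
    have h2 : HasDerivAt (fun t : ℝ => g (x + t • d)) ⟪gradient g (x + t • d), d⟫ t := by
      exact (hg (x + t • d)).hasGradientAt.hasFDerivAt.comp_hasDerivAt t h1
    have h3 := (h2.sub ((hasDerivAt_id t).mul_const ⟪gradient g x, d⟫)).sub
      ((hasDerivAt_pow 2 t).const_mul (L / 2 * ‖d‖ ^ 2))
    refine h3.congr_deriv ?_
    simp
  have hanti : AntitoneOn φ (Set.Icc 0 1) := by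
    refine antitoneOn_of_deriv_nonpos (convex_Icc 0 1)
      (fun t _ => (hφ t).continuousAt.continuousWithinAt)
      (fun t _ => (hφ t).differentiableAt.differentiableWithinAt) fun t ht => ?_
    rw [interior_Icc] at ht
    rw [(hφ t).deriv, ← inner_sub_left]
    have h1 := real_inner_le_norm (gradient g (x + t • d) - gradient g x) d
    have h2 := hL (x + t • d) x
    rw [add_sub_cancel_left, norm_smul, Real.norm_of_nonneg ht.1.le] at h2
    have h3 := mul_le_mul_of_nonneg_right h2 (norm_nonneg d)
    nlinarith
  have h := hanti (Set.left_mem_Icc.2 zero_le_one) (Set.right_mem_Icc.2 zero_le_one) zero_le_one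
  simp only [φ, one_smul, zero_smul, add_zero] at h
  linarith

/-- At `y - β • e`, the descent lemma from `y` bounds `g` above and the tangent at `x` bounds it
below. -/
theorem convex_lipschitz_gradient_lower_bound {g : H → ℝ} (hc : ConvexOn ℝ Set.univ g)
    (hg : Differentiable ℝ g) {β : ℝ} (hβ : 0 < β)
    (hL : ∀ u v, ‖gradient g u - gradient g v‖ ≤ (1 / β) * ‖u - v‖) (x y : H) :
    g x + ⟪gradient g x, y - x⟫ + β / 2 * ‖gradient g y - gradient g x‖ ^ 2 ≤ g y := by
  set e := gradient g y - gradient g x with he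
  have h1 := descent_lemma hg hL y (-(β • e))
  have h2 := convexOn_gradient_inequality hc (hg x).hasGradientAt (y + -(β • e))
  rw [show y + -(β • e) - x = (y - x) + -(β • e) by abel, inner_add_right] at h2
  have h3 : ⟪gradient g y, -(β • e)⟫ - ⟪gradient g x, -(β • e)⟫ = -(β * ‖e‖ ^ 2) := by
    rw [← inner_sub_left, ← he, inner_neg_right, real_inner_smul_right, real_inner_self_eq_norm_sq]
  have h4 : 1 / β / 2 * ‖-(β • e)‖ ^ 2 = β / 2 * ‖e‖ ^ 2 := by
    rw [norm_neg, norm_smul, Real.norm_of_nonneg hβ.le]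
    field_simp
  rw [h4] at h1
  linarith

/-- The Baillon–Haddad theorem. -/
theorem gradient_cocoercive {g : H → ℝ} (hc : ConvexOn ℝ Set.univ g)
    (hg : Differentiable ℝ g) {β : ℝ} (hβ : 0 < β)
    (hL : ∀ u v, ‖gradient g u - gradient g v‖ ≤ (1 / β) * ‖u - v‖) (x y : H) :
    β * ‖gradient g x - gradient g y‖ ^ 2 ≤ ⟪gradient g x - gradient g y, x - y⟫ := by
  have h1 := convex_lipschitz_gradient_lower_bound hc hg hβ hL x y
  have h2 := convex_lipschitz_gradient_lower_bound hc hg hβ hL y x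
  rw [norm_sub_rev, ← neg_sub x y, inner_neg_right] at h1
  rw [inner_sub_left]
  linarith

end Cocoercive

/-! ### The forward-backward operator and conclusion -/

/-- The relaxation of a forward-backward step given by `(1 + κ) T - κ I` with
`κ = 1 - γ / (2 β)` is nonexpansive: here `d`, `e`, `p` are the differences of the points, of the
gradients and of the images under `T`. -/
theorem norm_relaxed_forwardBackward_le {H : Type*} [NormedAddCommGroup H] [InnerProductSpace ℝ H]
    {β γ : ℝ} (hβ : 0 < β) (hγ : 0 < γ) (hγβ : γ ≤ 2 * β) {d e p : H}
    (hp : 0 ≤ ⟪d - γ • e - p, p⟫) (he : β * ‖e‖ ^ 2 ≤ ⟪e, d⟫) :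
    ‖(2 - γ / (2 * β)) • p - (1 - γ / (2 * β)) • d‖ ≤ ‖d‖ := by
  set c := γ / (2 * β) with hc
  have hc1 : c ≤ 1 := by rw [hc, div_le_one (by positivity)]; exact hγβ
  have hc0 : 0 < c := by positivity
  have hcβ : γ = 2 * β * c := by rw [hc]; field_simp
  refine le_of_sq_le_sq ?_ (norm_nonneg _)
  rw [norm_sub_sq_real, norm_smul, norm_smul, real_inner_smul_left, real_inner_smul_right, mul_pow,
    mul_pow, Real.norm_eq_abs, Real.norm_eq_abs, sq_abs, sq_abs]
  rw [inner_sub_left, inner_sub_left, real_inner_smul_left, real_inner_self_eq_norm_sq,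
    real_inner_comm] at hp
  -- With weight `c`, the coefficient `2 * β` cancels the `⟪e, p⟫` term of `2 * hp`, as `γ = 2 * β *
  -- c`; cocoercivity absorbs the other terms in `e`.
  have h1 : 0 ≤ ‖(p - d) + (2 * β) • e‖ ^ 2 := sq_nonneg _
  rw [norm_add_sq_real, norm_sub_sq_real, norm_smul, mul_pow, Real.norm_eq_abs, sq_abs,
    real_inner_smul_right, inner_sub_left, real_inner_comm e p, real_inner_comm e d] at h1
  have h2 : (2 - c) * ‖p‖ ^ 2 - 2 * (1 - c) * ⟪p, d⟫ - c * ‖d‖ ^ 2 ≤ 0 := by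
    have h3 := mul_nonneg hc0.le h1
    have h4 := mul_le_mul_of_nonneg_left he hγ.le
    rw [hcβ] at h4 hp
    linarith
  nlinarith [mul_nonneg (show 0 ≤ 2 - c by linarith) (neg_nonneg.2 h2)]

end TikhonovFB

theorem corollary3p4 {H : Type*} [NormedAddCommGroup H] [InnerProductSpace ℝ H] [CompleteSpace H]
    (f : H → EReal) (hf_proper : TikhonovFB.IsProper f) (hf_convex : TikhonovFB.IsConvex f)
    (hf_lsc : LowerSemicontinuous f)
    (g : H → ℝ) (hg_convex : ConvexOn ℝ Set.univ g) (hg_diff : Differentiable ℝ g)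
    (β : ℝ) (hβ : 0 < β)
    (hg_lip : ∀ u v : H, ‖gradient g u - gradient g v‖ ≤ (1 / β) * ‖u - v‖)
    (hargmin : (TikhonovFB.argmin fun u => f u + (g u : EReal)).Nonempty)
    (γ : ℝ) (hγ_pos : 0 < γ) (hγ_le : γ ≤ 2 * β)
    (b lam : ℕ → ℝ)
    (hb_mem : ∀ n, 0 < b n ∧ b n ≤ 1)
    (hb_lim : Tendsto b atTop (𝓝 1))
    (hb_div : Tendsto (fun N => ∑ n ∈ Finset.range N, (1 - b n)) atTop atTop)
    (hb_var : Summable fun n => |b (n + 1) - b n|)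
    (hlam_mem : ∀ n, 0 < lam n ∧ lam n ≤ (4 * β - γ) / (2 * β))
    (hlam_liminf : 0 < liminf lam atTop)
    (hlam_var : Summable fun n => |lam (n + 1) - lam n|)
    (x : ℕ → H)
    (hx : ∀ n, x (n + 1) = ((1 - lam n) * b n) • x n +
      lam n • TikhonovFB.prox (fun u => (γ : EReal) * f u)
        (b n • x n - γ • gradient g (b n • x n))) :
    (∀ v : H, ∃! p : H, p ∈ TikhonovFB.argmin
      (TikhonovFB.proxObjective (fun u => (γ : EReal) * f u) v)) ∧
    ∃ xbar ∈ TikhonovFB.argmin (fun u => f u + (g u : EReal)),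
      (∀ z ∈ TikhonovFB.argmin (fun u => f u + (g u : EReal)), z ≠ xbar → ‖xbar‖ < ‖z‖) ∧
      Tendsto x atTop (𝓝 xbar) := by
  have hF := hf_proper.coe_mul hγ_pos
  have hFc := hf_convex.coe_mul hf_proper hγ_pos
  have hsub : ∀ p, p ∈ TikhonovFB.argmin (fun u => f u + (g u : EReal)) ↔
      TikhonovFB.IsSubgradientAt (fun u => (γ : EReal) * f u) p (γ • -gradient g p) := by
    intro p
    rw [TikhonovFB.isSubgradientAt_coe_mul_iff hf_proper hγ_pos]
    exact ⟨TikhonovFB.isSubgradientAt_of_mem_argmin_add hf_proper hf_convex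
      (hg_diff p).hasGradientAt, TikhonovFB.mem_argmin_add_of_isSubgradientAt hf_proper
      (TikhonovFB.convexOn_gradient_inequality hg_convex (hg_diff p).hasGradientAt)⟩
  obtain ⟨p₀, hp₀⟩ := hargmin
  have hprox := TikhonovFB.existsUnique_mem_argmin_proxObjective hF hFc
    (TikhonovFB.isClosed_coe_mul_le_of_lowerSemicontinuous hf_lsc hγ_pos) ((hsub p₀).1 hp₀)
  refine ⟨hprox, ?_⟩
  set P := TikhonovFB.prox (fun u => (γ : EReal) * f u) with hP
  have hPmem : ∀ v, TikhonovFB.IsSubgradientAt (fun u => (γ : EReal) * f u) (P v) (v - P v) :=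
    fun v => (TikhonovFB.mem_argmin_proxObjective_iff hF hFc).1
      (Classical.epsilon_spec (hprox v).exists)
  set T : H → H := fun u => P (u - γ • gradient g u) with hT
  have hfix : ∀ p, T p = p ↔ p ∈ TikhonovFB.argmin (fun u => f u + (g u : EReal)) := by
    intro p
    have hv : p - γ • gradient g p - p = γ • -gradient g p := by module
    rw [hsub]
    constructor
    · intro h
      have h1 := hPmem (p - γ • gradient g p)
      rw [show P (p - γ • gradient g p) = p from h, hv] at h1
      exact h1
    · intro h
      rw [← hv] at h
      exact (hprox _).unique (Classical.epsilon_spec (hprox _).exists)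
        ((TikhonovFB.mem_argmin_proxObjective_iff hF hFc).2 h)
  set c := γ / (2 * β) with hc
  have hc1 : c ≤ 1 := by rw [hc, div_le_one (by positivity)]; exact hγ_le
  have hα : 0 < 2 - c := by linarith
  have hαeq : (4 * β - γ) / (2 * β) = 2 - c := by rw [hc]; field_simp; ring
  set R : H → H := fun u => (2 - c) • T u - (1 - c) • u with hRdef
  have hRfix : ∀ p, R p = p ↔ T p = p := by
    intro p
    have h1 : R p - p = (2 - c) • (T p - p) := by simp only [hRdef]; module
    rw [← sub_eq_zero, h1, smul_eq_zero_iff_right hα.ne', sub_eq_zero]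
  have hR : ∀ u v, ‖R u - R v‖ ≤ ‖u - v‖ := by
    intro u v
    have h1 : R u - R v = (2 - c) • (T u - T v) - (1 - c) • (u - v) := by
      simp only [hRdef]; module
    rw [h1]
    refine TikhonovFB.norm_relaxed_forwardBackward_le hβ hγ_pos hγ_le
      (e := gradient g u - gradient g v) ?_
      (TikhonovFB.gradient_cocoercive hg_convex hg_diff hβ hg_lip u v)
    have h2 := (hPmem (u - γ • gradient g u)).monotone (hPmem (v - γ • gradient g v))
    convert h2 using 2
    simp only [hT]
    module
  obtain ⟨δ, hδ0, hδ⟩ := exists_between hlam_liminf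
  have hbdd : IsBoundedUnder (· ≥ ·) atTop lam :=
    isBoundedUnder_of ⟨0, fun n => (hlam_mem n).1.le⟩
  have hev := eventually_lt_of_lt_liminf hδ hbdd
  -- Since `R - I = (2 - c)(T - I)`, dividing `lam n` by `2 - c` leaves the step unchanged, and the
  -- upper bound on `lam n` is exactly `μ n ≤ 1`.
  obtain ⟨w, hw, hmin, hlim⟩ := TikhonovFB.exists_minNorm_fixedPoint_tendsto hR
    (p := p₀) ((hRfix _).2 ((hfix _).2 hp₀)) (b := b) (μ := fun n => lam n / (2 - c)) (x := x)
    (c := δ / (2 - c)) hb_mem hb_lim hb_div hb_var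
    (fun n => ⟨div_pos (hlam_mem n).1 hα, (div_le_one hα).2 (hαeq ▸ (hlam_mem n).2)⟩)
    (div_pos hδ0 hα) (hev.mono fun n hn => div_le_div_of_nonneg_right hn.le hα.le)
    (by
      refine (hlam_var.div_const (2 - c)).congr fun n => ?_
      rw [← sub_div, abs_div, abs_of_pos hα])
    (fun n => by
      have h1 : R (b n • x n) - b n • x n = (2 - c) • (T (b n • x n) - b n • x n) := by
        simp only [hRdef]; module
      rw [hx n, h1, smul_smul, div_mul_cancel₀ _ hα.ne']
      simp only [hT]
      module)
  refine ⟨w, (hfix w).1 ((hRfix w).1 hw), fun z hz hzw => ?_, hlim⟩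
  exact hmin z ((hRfix z).2 ((hfix z).2 hz)) hzw
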